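/- Setting. Let $K, D$ be natural numbers and let $G=(\mathcal V,\mathcal E)$ be a finite simple graph in which every edge $e$ is labelled by a set $t(e)\subseteq[K]=\{1,\dots,K\}$ with $|t(e)|=D$ or $t(e)=\emptyset$. A secure storage code over $G$ consists of jointly distributed finite-valued random variables: source symbols $W_1,\dots,W_K$, which are independent with $H(W_1)=\dots=H(W_K)=L_w>0$, and coded symbols $X_v$ ($v\in\mathcal V$), each stored in an alphabet of size $2^{L_v}$, $L_v>0$ (the encoding may be randomized), such that for every edge $\{u,v\}$ with $t(\{u,v\})=\mathcal D$ $$H\big((W_k)_{k\in\mathcal D}\mid X_u,X_v\big)=0,\qquad I\big(X_u,X_v;(W_k)_{k\in[K]\setminus\mathcal D}\mid (W_k)_{k\in\mathcal D}\big)=0 .$$ Its symbol rate is $L_w/L_v$, and the capacity of $G$ is the supremum of the symbol rates of all secure storage codes over $G$. For a node $v$ let $\mathcal C(v)=\bigcap_{u:\{v,u\}\in\mathcal E}t(\{v,u\})$. The node $v$ is degenerate if $t(\{v,u\})=\mathcal C(v)$ for every edge $\{v,u\}$, and $\widetilde G$ is the subgraph of $G$ induced by the non-degenerate nodes. An edge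 $e$ is qualified if $t(e)\ne\emptyset$ and unqualified if $t(e)=\emptyset$; a qualified (unqualified) path is a sequence of connecting qualified (unqualified) edges. A qualified component is a maximal induced subgraph in which any two nodes are connected by a qualified path. An internal qualified edge is a qualified edge that connects two nodes of an unqualified path. For a labelled graph $Q$ and $k\in[K]$, the characteristic graph $Q^{[k]}$ has the same nodes and edges as $Q$, and the label of an edge $e$ is $\{k\}$ if $k\in t(e)$ and $\emptyset$ otherwise. Theorem. Suppose that $\widetilde G$ is not empty and that $\mathcal C(v)=\emptyset$ for every non-degenerate node $v$ of $G$. Then the capacity of $G$ equals $1/D$ if and only if for every qualified component $Q$ of $\widetilde G$ and every $k\in[K]$, the characteristic graph $Q^{[k]}$ contains no internal qualified edge. -/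

import Mathlib

noncomputable section

/-! ### Shannon entropies of finite-valued random variables, in bits -/

/-- Shannon entropy `H(X)` of a random variable `X` with values in a finite type. -/
def entropy {Ω S : Type*} [Fintype S] (p : PMF Ω) (X : Ω → S) : ℝ :=
  ∑ x : S, Real.negMulLog ((p.map X) x).toReal / Real.log 2

/-- Conditional entropy `H(X | Y) = H(X, Y) - H(Y)`. -/
def condEntropy {Ω S T : Type*} [Fintype S] [Fintype T] (p : PMF Ω)
    (X : Ω → S) (Y : Ω → T) : ℝ :=
  entropy p (fun ω => (X ω, Y ω)) - entropy p Y

/-- Conditional mutual information `I(X ; Y | Z) = H(X | Z) - H(X | Y, Z)`. -/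
def condMutualInfo {Ω S T U : Type*} [Fintype S] [Fintype T] [Fintype U] (p : PMF Ω)
    (X : Ω → S) (Y : Ω → T) (Z : Ω → U) : ℝ :=
  condEntropy p X Z - condEntropy p X (fun ω => (Y ω, Z ω))

/-! ### Graphs with source symbols on the edges -/

/-- A graph whose edges are associated with a set of exactly `D` of the `K` source symbols, or with
no source symbol. Only the values of `t` on edges are ever used. -/
structure StorageGraph (V : Type*) (K D : ℕ) where
  graph : SimpleGraph V
  t : Sym2 V → Finset (Fin K)
  card_t : ∀ e ∈ graph.edgeSet, (t e).card = D ∨ t e = ∅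

namespace StorageGraph

/-- The subgraph induced by a set of nodes. -/
def induce {V : Type*} {K D : ℕ} (G : StorageGraph V K D) (S : Set V) : StorageGraph S K D where
  graph := G.graph.induce S
  t e := G.t (e.map Subtype.val)
  card_t := by
    intro e he
    induction e using Sym2.ind with
    | _ u v => exact G.card_t s(u.1, v.1) he

/-- The characteristic graph `G^[k]` of the source symbol `W_k`. -/
def charGraph {V : Type*} {K D : ℕ} (G : StorageGraph V K D) (k : Fin K) :
    StorageGraph V K 1 where
  graph := G.graph
  t e := if k ∈ G.t e then {k} else ∅
  card_t := by
    intro e _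
    by_cases h : k ∈ G.t e <;> simp [h]

/-- The common sources `𝒞(v)`: the intersection of the sets associated with the edges at `v`. -/
def commonSources {V : Type*} {K D : ℕ} (G : StorageGraph V K D) (v : V) : Set (Fin K) :=
  ⋂ u ∈ G.graph.neighborSet v, (G.t s(v, u) : Set (Fin K))

/-- A node is degenerate if all its edges are associated with the same set of source symbols. -/
def IsDegenerate {V : Type*} {K D : ℕ} (G : StorageGraph V K D) (v : V) : Prop :=
  ∀ u, G.graph.Adj v u → (G.t s(v, u) : Set (Fin K)) = G.commonSources v

def nonDegenerateNodes {V : Type*} {K D : ℕ} (G : StorageGraph V K D) : Set V :=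
  {v | ¬ G.IsDegenerate v}

/-- The non-degenerate subgraph of `G`. -/
def nonDegenerateSubgraph {V : Type*} {K D : ℕ} (G : StorageGraph V K D) :
    StorageGraph G.nonDegenerateNodes K D :=
  G.induce G.nonDegenerateNodes

/-- The simple graph formed by the qualified edges; a qualified path is a walk in it. -/
def qualifiedGraph {V : Type*} {K D : ℕ} (G : StorageGraph V K D) : SimpleGraph V where
  Adj u v := G.graph.Adj u v ∧ G.t s(u, v) ≠ ∅
  symm := ⟨fun u v h => ⟨h.1.symm, by rw [Sym2.eq_swap]; exact h.2⟩⟩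
  loopless := ⟨fun v h => G.graph.loopless.irrefl v h.1⟩

/-- The simple graph formed by the unqualified edges; an unqualified path is a walk in it. -/
def unqualifiedGraph {V : Type*} {K D : ℕ} (G : StorageGraph V K D) : SimpleGraph V where
  Adj u v := G.graph.Adj u v ∧ G.t s(u, v) = ∅
  symm := ⟨fun u v h => ⟨h.1.symm, by rw [Sym2.eq_swap]; exact h.2⟩⟩
  loopless := ⟨fun v h => G.graph.loopless.irrefl v h.1⟩

/-- `S` is the node set of a qualified component: the subgraph induced by `S` is a maximal (nonempty)
induced subgraph in which any two nodes are connected by a qualified path. -/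
def IsQualifiedComponent {V : Type*} {K D : ℕ} (G : StorageGraph V K D) (S : Set V) : Prop :=
  Maximal (fun S' : Set V => (G.induce S').qualifiedGraph.Connected) S

/-- Some qualified edge connects two nodes of an unqualified path. -/
def HasInternalQualifiedEdge {V : Type*} {K D : ℕ} (G : StorageGraph V K D) : Prop :=
  ∃ u v : V, G.qualifiedGraph.Adj u v ∧
    ∃ (a b : V) (p : G.unqualifiedGraph.Walk a b), u ∈ p.support ∧ v ∈ p.support

/-! ### Secure storage codes and capacity -/

/-- A secure storage code over `G`: source symbols `W k` and coded symbols `X v`, random variables on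
a common finite probability space. The encoder may use noise, so the joint law of `(W, X)` is only
constrained by the fields below. Each source symbol has entropy `Lw` bits; each coded symbol is
stored in the finite alphabet `B`, thus has size `log₂ |B|` bits. -/
structure SecureStorageCode {V : Type*} {K D : ℕ} (G : StorageGraph V K D) where
  Ω : Type
  A : Type
  B : Type
  [fintypeΩ : Fintype Ω]
  [fintypeA : Fintype A]
  [fintypeB : Fintype B]
  p : PMF Ω
  W : Fin K → Ω → A
  X : V → Ω → B
  Lw : ℝ
  Lw_pos : 0 < Lw
  one_lt_card : 1 < Fintype.card B
  entropy_source : ∀ k, entropy p (W k) = Lw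
  indep_source : entropy p (fun ω k => W k ω) = ∑ k, entropy p (W k)
  correctness : ∀ u v, G.graph.Adj u v →
    condEntropy p (fun ω (k : ↥(G.t s(u, v))) => W k ω) (fun ω => (X u ω, X v ω)) = 0
  security : ∀ u v, G.graph.Adj u v →
    condMutualInfo p (fun ω => (X u ω, X v ω))
      (fun ω (k : ↥((G.t s(u, v))ᶜ)) => W k ω) (fun ω (k : ↥(G.t s(u, v))) => W k ω) = 0

/-- The size `L_v` of each coded symbol, in bits. -/
def SecureStorageCode.Lv {V : Type*} {K D : ℕ} {G : StorageGraph V K D}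
    (c : G.SecureStorageCode) : ℝ :=
  letI := c.fintypeB
  Real.logb 2 (Fintype.card c.B)

/-- The symbol rate `L_w / L_v`. -/
def SecureStorageCode.rate {V : Type*} {K D : ℕ} {G : StorageGraph V K D}
    (c : G.SecureStorageCode) : ℝ :=
  c.Lw / c.Lv

/-- The capacity: the supremum of the symbol rates (`⊤` if they are unbounded). -/
def capacity {V : Type*} {K D : ℕ} (G : StorageGraph V K D) : EReal :=
  ⨆ c : G.SecureStorageCode, (c.rate : EReal)

end StorageGraph

end

/-! ### Entropy inequalities on a finite probability space -/

section Entropy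

variable {Ω S T U R : Type*} [Fintype Ω] [Fintype S] [Fintype T] [Fintype U] [Fintype R]
  (p : PMF Ω)

/-! Converse. Let the excess be `Lv - D * Lw`, and measure closeness of coded symbols by the gap
H(X_v | X_u, W_S), a directed pseudo-distance that shrinks as S grows. If u has no common source,
then X_u is independent of all the sources, because each edge at u confines its dependence to that
edge's label and these confinements intersect. For such u three edge estimates hold. A qualified
edge has gap at most the excess once its own label is given. An unqualified edge has the same gap
whether or not the sources are given (`gap_empty_le`), so a qualified path between its ends bounds
it by a multiple of the excess. An edge carrying k has gap at least `Lw` when all sources but W_k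
are given (`Lw_le_gap`).

The first estimate makes the excess nonnegative, so the capacity is at most 1/D. If an edge carrying
k is internal, its ends are also joined by a path of edges avoiding k, and the triangle inequality
gives `Lw ≤ N * excess`. Since N depends only on the graph, the supremum of the rates stays strictly
below 1/D.

Achievability. Over a large prime field, give each qualified component of non-degenerate nodes one
uniform noise vector of length D. Add to it a combination of the vectors w_k (1, y_k, y_k², …) with
distinct y_k, the coefficient of w_k at v naming the component of v in `avoidingGraph k`. Across an
edge inside a qualified component the noise cancels, and the coefficients differ exactly for the k
in its label: this is where the absence of internal qualified edges enters. A Vandermonde system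
then returns the D labelled sources. Edges between distinct components are unqualified and are
protected by independent noises. Degenerate nodes store their common sources without noise. -/

omit [Fintype S] in
theorem toReal_map_apply [DecidableEq S] (X : Ω → S) (x : S) :
    ((p.map X) x).toReal = ∑ ω, if X ω = x then (p ω).toReal else 0 := by
  rw [PMF.map_apply, tsum_fintype, ENNReal.toReal_sum]
  · refine Finset.sum_congr rfl fun ω _ => ?_
    by_cases h : X ω = x
    · simp [h]
    · simp [h, Ne.symm h]
  · intro ω _
    split_ifs
    · exact p.apply_ne_top ω
    · simp

theorem sum_toReal_map_mul (X : Ω → S) (f : S → ℝ) :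
    ∑ x, ((p.map X) x).toReal * f x = ∑ ω, (p ω).toReal * f (X ω) := by
  classical
  simp_rw [toReal_map_apply, Finset.sum_mul]
  rw [Finset.sum_comm]
  refine Finset.sum_congr rfl fun ω _ => ?_
  simp [ite_mul]

theorem sum_toReal_pmf : ∑ ω, (p ω).toReal = 1 := by
  have h := p.tsum_coe
  rw [tsum_fintype] at h
  rw [← ENNReal.toReal_sum (fun ω _ => p.apply_ne_top ω), h, ENNReal.toReal_one]

omit [Fintype Ω] in
theorem sum_toReal_map (X : Ω → S) : ∑ x, ((p.map X) x).toReal = 1 :=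
  sum_toReal_pmf (p.map X)

omit [Fintype S] in
theorem toReal_le_toReal_map (X : Ω → S) (ω : Ω) : (p ω).toReal ≤ ((p.map X) (X ω)).toReal := by
  classical
  rw [toReal_map_apply]
  refine le_trans (by simp) (Finset.single_le_sum (f := fun ω' => if X ω' = X ω then
    (p ω').toReal else 0) (fun i _ => ?_) (Finset.mem_univ ω))
  split_ifs <;> simp

omit [Fintype S] [Fintype T] in
theorem toReal_map_le_of_determines (X : Ω → S) (Y : Ω → T)
    (h : ∀ ω ω', X ω = X ω' → Y ω = Y ω') (ω : Ω) :
    ((p.map X) (X ω)).toReal ≤ ((p.map Y) (Y ω)).toReal := by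
  classical
  rw [toReal_map_apply, toReal_map_apply]
  refine Finset.sum_le_sum fun i _ => ?_
  by_cases hi : X i = X ω
  · rw [if_pos hi, if_pos (h _ _ hi)]
  · rw [if_neg hi]
    split_ifs <;> simp

/-- Writing entropy as an expectation over Ω allows variables with different alphabets to be
compared outcome by outcome. -/
theorem entropy_mul_log_two (X : Ω → S) :
    entropy p X * Real.log 2 = ∑ ω, (p ω).toReal * -Real.log ((p.map X) (X ω)).toReal := by
  have h2 : Real.log 2 ≠ 0 := (Real.log_pos one_lt_two).ne'
  rw [← sum_toReal_map_mul p X fun x => -Real.log ((p.map X) x).toReal, entropy, Finset.sum_mul]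
  refine Finset.sum_congr rfl fun x _ => ?_
  rw [div_mul_cancel₀ _ h2, Real.negMulLog]
  ring

/-- The fibre of X through ω lies inside the fibre of Y, so Y is pointwise at least as likely. -/
theorem entropy_le_of_determines (X : Ω → S) (Y : Ω → T)
    (h : ∀ ω ω', X ω = X ω' → Y ω = Y ω') : entropy p Y ≤ entropy p X := by
  have h2 : 0 < Real.log 2 := Real.log_pos one_lt_two
  refine le_of_mul_le_mul_right ?_ h2
  rw [entropy_mul_log_two, entropy_mul_log_two]
  refine Finset.sum_le_sum fun ω _ => ?_
  rcases (ENNReal.toReal_nonneg (a := p ω)).eq_or_lt' with h0 | h0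
  · simp [h0]
  · have h1 := h0.trans_le (toReal_le_toReal_map p X ω)
    have := Real.log_le_log h1 (toReal_map_le_of_determines p X Y h ω)
    exact mul_le_mul_of_nonneg_left (neg_le_neg this) h0.le

theorem entropy_eq_of_determines (X : Ω → S) (Y : Ω → T)
    (h : ∀ ω ω', X ω = X ω' ↔ Y ω = Y ω') : entropy p X = entropy p Y :=
  le_antisymm (entropy_le_of_determines p Y X fun ω ω' => (h ω ω').2)
    (entropy_le_of_determines p X Y fun ω ω' => (h ω ω').1)

theorem entropy_nonneg (X : Ω → S) : 0 ≤ entropy p X := by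
  have h2 : 0 < Real.log 2 := Real.log_pos one_lt_two
  refine Finset.sum_nonneg fun x _ => div_nonneg (Real.negMulLog_nonneg ENNReal.toReal_nonneg ?_)
    h2.le
  exact ENNReal.toReal_le_of_le_ofReal zero_le_one (by simpa using (p.map X).coe_le_one x)

omit [Fintype Ω] in
theorem entropy_le_logb_card [Nonempty S] (X : Ω → S) :
    entropy p X ≤ Real.logb 2 (Fintype.card S) := by
  have h2 : 0 < Real.log 2 := Real.log_pos one_lt_two
  have hn : (0 : ℝ) < Fintype.card S := by exact_mod_cast Fintype.card_pos
  rw [Real.logb, le_div_iff₀ h2, entropy, Finset.sum_mul]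
  -- Gibbs' inequality against the uniform law: log r ≤ r - 1 at r = 1/(nq), with n the alphabet
  -- size. The corrections 1/n - q sum to zero.
  have key : ∀ x, Real.negMulLog ((p.map X) x).toReal / Real.log 2 * Real.log 2 ≤
      ((p.map X) x).toReal * Real.log (Fintype.card S) +
        ((Fintype.card S : ℝ)⁻¹ - ((p.map X) x).toReal) := by
    intro x
    rw [div_mul_cancel₀ _ h2.ne', Real.negMulLog]
    rcases (ENNReal.toReal_nonneg (a := (p.map X) x)).eq_or_lt' with h0 | h0
    · rw [h0]
      simp
    · set q := ((p.map X) x).toReal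
      have := Real.log_le_sub_one_of_pos (x := (Fintype.card S : ℝ)⁻¹ * q⁻¹) (by positivity)
      rw [Real.log_mul (by positivity) (by positivity), Real.log_inv, Real.log_inv] at this
      have h3 := mul_le_mul_of_nonneg_left this h0.le
      have h4 : q * ((Fintype.card S : ℝ)⁻¹ * q⁻¹ - 1) = (Fintype.card S : ℝ)⁻¹ - q := by
        field_simp
      rw [h4] at h3
      linarith
  refine (Finset.sum_le_sum fun x _ => key x).trans (le_of_eq ?_)
  rw [Finset.sum_add_distrib, ← Finset.sum_mul, Finset.sum_sub_distrib, sum_toReal_map]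
  simp [hn.ne']

omit [Fintype R] in
theorem sum_toReal_map_prodMk (X : Ω → S) (Z : Ω → R) (z : R) :
    ∑ x, ((p.map fun ω => (X ω, Z ω)) (x, z)).toReal = ((p.map Z) z).toReal := by
  classical
  simp_rw [toReal_map_apply]
  rw [Finset.sum_comm]
  refine Finset.sum_congr rfl fun ω _ => ?_
  by_cases h : Z ω = z <;> simp [h]

theorem entropy_submodular_triple (X : Ω → S) (Y : Ω → T) (Z : Ω → R) :
    entropy p (fun ω => (X ω, Y ω, Z ω)) + entropy p Z ≤
      entropy p (fun ω => (X ω, Z ω)) + entropy p (fun ω => (Y ω, Z ω)) := by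
  have h2 : 0 < Real.log 2 := Real.log_pos one_lt_two
  refine le_of_mul_le_mul_right ?_ h2
  rw [add_mul, add_mul, entropy_mul_log_two, entropy_mul_log_two, entropy_mul_log_two,
    entropy_mul_log_two, ← Finset.sum_add_distrib, ← Finset.sum_add_distrib]
  set a := fun s : S × T × R => ((p.map fun ω => (X ω, Y ω, Z ω)) s).toReal with ha
  set b := fun z : R => ((p.map Z) z).toReal with hb
  set c := fun s : S × R => ((p.map fun ω => (X ω, Z ω)) s).toReal with hc
  set d := fun s : T × R => ((p.map fun ω => (Y ω, Z ω)) s).toReal with hd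
  have a0 : ∀ s, 0 ≤ a s := fun s => ENNReal.toReal_nonneg
  have b0 : ∀ s, 0 ≤ b s := fun s => ENNReal.toReal_nonneg
  have c0 : ∀ s, 0 ≤ c s := fun s => ENNReal.toReal_nonneg
  have d0 : ∀ s, 0 ≤ d s := fun s => ENNReal.toReal_nonneg
  -- The likelihood ratio of the law making X and Y conditionally independent given Z to the true
  -- law. The inequality is log r ≤ r - 1 in expectation.
  set r := fun s : S × T × R => c (s.1, s.2.2) * d s.2 / (a s * b s.2.2) with hr
  have key : ∀ ω, (p ω).toReal * -Real.log (a (X ω, Y ω, Z ω)) + (p ω).toReal * -Real.log (b (Z ω))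
      ≤ ((p ω).toReal * -Real.log (c (X ω, Z ω)) + (p ω).toReal * -Real.log (d (Y ω, Z ω))) +
        ((p ω).toReal * r (X ω, Y ω, Z ω) - (p ω).toReal) := by
    intro ω
    rcases (ENNReal.toReal_nonneg (a := p ω)).eq_or_lt' with h0 | h0
    · simp [h0]
    · have a1 : 0 < a (X ω, Y ω, Z ω) :=
        h0.trans_le (toReal_le_toReal_map p (fun ω => (X ω, Y ω, Z ω)) ω)
      have b1 : 0 < b (Z ω) := h0.trans_le (toReal_le_toReal_map p Z ω)
      have c1 : 0 < c (X ω, Z ω) := h0.trans_le (toReal_le_toReal_map p (fun ω => (X ω, Z ω)) ω)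
      have d1 : 0 < d (Y ω, Z ω) := h0.trans_le (toReal_le_toReal_map p (fun ω => (Y ω, Z ω)) ω)
      have := Real.log_le_sub_one_of_pos (x := r (X ω, Y ω, Z ω)) (by simp only [hr]; positivity)
      have hl : Real.log (r (X ω, Y ω, Z ω)) = Real.log (c (X ω, Z ω)) + Real.log (d (Y ω, Z ω)) -
          (Real.log (a (X ω, Y ω, Z ω)) + Real.log (b (Z ω))) := by
        simp only [hr]
        rw [Real.log_div (by positivity) (by positivity), Real.log_mul c1.ne' d1.ne',
          Real.log_mul a1.ne' b1.ne']
      rw [hl] at this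
      nlinarith [mul_le_mul_of_nonneg_left this h0.le]
  -- Only an inequality, since the comparison law may charge triples of true probability zero.
  have hsum : ∑ ω, (p ω).toReal * r (X ω, Y ω, Z ω) ≤ 1 := by
    rw [← sum_toReal_map_mul p (fun ω => (X ω, Y ω, Z ω)) r]
    calc ∑ s, a s * r s ≤ ∑ s : S × T × R, c (s.1, s.2.2) * d s.2 / b s.2.2 := by
          refine Finset.sum_le_sum fun s _ => ?_
          rcases (a0 s).eq_or_lt' with h0 | h0
          · rw [h0, zero_mul]
            exact div_nonneg (mul_nonneg (c0 _) (d0 _)) (b0 _)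
          · refine le_of_eq ?_
            simp only [hr]
            rw [← mul_div_assoc, mul_div_mul_left _ _ h0.ne']
      _ = ∑ z, (∑ x, c (x, z)) * (∑ y, d (y, z)) / b z := by
          rw [Fintype.sum_prod_type]
          simp_rw [Fintype.sum_prod_type, Finset.sum_mul_sum, Finset.sum_div]
          simp_rw [Finset.sum_comm (s := (Finset.univ : Finset R))]
      _ = ∑ z, b z := by
          refine Finset.sum_congr rfl fun z _ => ?_
          rw [sum_toReal_map_prodMk, sum_toReal_map_prodMk]
          exact mul_self_div_self _
      _ = 1 := sum_toReal_map p Z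
  have := Finset.sum_le_sum fun ω (_ : ω ∈ Finset.univ) => key ω
  rw [Finset.sum_add_distrib (g := fun ω => (p ω).toReal * r (X ω, Y ω, Z ω) - (p ω).toReal),
    Finset.sum_sub_distrib, sum_toReal_pmf] at this
  linarith

/-- Submodularity of entropy, for variables compared by what they determine. -/
theorem entropy_submodular (X : Ω → S) (Y : Ω → T) (J : Ω → U) (M : Ω → R)
    (hJ : ∀ ω ω', X ω = X ω' → Y ω = Y ω' → J ω = J ω')
    (hX : ∀ ω ω', X ω = X ω' → M ω = M ω') (hY : ∀ ω ω', Y ω = Y ω' → M ω = M ω') :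
    entropy p J + entropy p M ≤ entropy p X + entropy p Y := by
  have h1 := entropy_submodular_triple p X Y M
  have h2 := entropy_le_of_determines p (fun ω => (X ω, Y ω, M ω)) J (by
    intro ω ω' h
    simp only [Prod.mk.injEq] at h
    exact hJ _ _ h.1 h.2.1)
  have h3 := entropy_le_of_determines p X (fun ω => (X ω, M ω)) (by
    intro ω ω' h
    simp [h, hX _ _ h])
  have h4 := entropy_le_of_determines p Y (fun ω => (Y ω, M ω)) (by
    intro ω ω' h
    simp [h, hY _ _ h])
  linarith

theorem entropy_eq_zero_of_subsingleton [Subsingleton S] (X : Ω → S) : entropy p X = 0 := by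
  cases isEmpty_or_nonempty S
  · simp [entropy]
  · refine le_antisymm ?_ (entropy_nonneg p X)
    have := entropy_le_logb_card p X
    rwa [le_antisymm (Fintype.card_le_one_iff_subsingleton.2 ‹_›) Fintype.card_pos, Nat.cast_one,
      Real.logb_one] at this

theorem entropy_prodMk_le (X : Ω → S) (Y : Ω → T) :
    entropy p (fun ω => (X ω, Y ω)) ≤ entropy p X + entropy p Y := by
  have := entropy_submodular p X Y (fun ω => (X ω, Y ω)) (fun _ => ()) (by simp_all) (by simp)
    (by simp)
  rwa [entropy_eq_zero_of_subsingleton p fun _ => (), add_zero] at this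

end Entropy

/-! ### Upper bounds on the symbol rate -/

namespace StorageGraph

namespace SecureStorageCode

attribute [instance] SecureStorageCode.fintypeΩ SecureStorageCode.fintypeA
  SecureStorageCode.fintypeB

variable {V : Type*} {K D : ℕ} {G : StorageGraph V K D} (c : G.SecureStorageCode)

/-- The tuple `(W k)` for `k ∈ S`. -/
def sourceOn (S : Finset (Fin K)) : c.Ω → (↥S → c.A) := fun ω k => c.W k ω

theorem sourceOn_eq_iff {S : Finset (Fin K)} {ω ω' : c.Ω} :
    c.sourceOn S ω = c.sourceOn S ω' ↔ ∀ k ∈ S, c.W k ω = c.W k ω' := by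
  simp [sourceOn, funext_iff]

theorem entropy_sourceOn_union_le (S T : Finset (Fin K)) :
    entropy c.p (c.sourceOn (S ∪ T)) ≤
      entropy c.p (c.sourceOn S) + entropy c.p (c.sourceOn T) := by
  refine le_trans ?_ (entropy_prodMk_le c.p _ _)
  refine entropy_le_of_determines _ _ _ fun ω ω' h => ?_
  simp only [Prod.mk.injEq, sourceOn_eq_iff] at h ⊢
  intro k hk
  exact (Finset.mem_union.1 hk).elim (h.1 k) (h.2 k)

theorem entropy_sourceOn_le (S : Finset (Fin K)) :
    entropy c.p (c.sourceOn S) ≤ S.card * c.Lw := by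
  induction S using Finset.induction_on with
  | empty => rw [entropy_eq_zero_of_subsingleton]; simp
  | insert a S ha ih =>
    have h1 := c.entropy_sourceOn_union_le {a} S
    have h2 : entropy c.p (c.sourceOn {a}) = entropy c.p (c.W a) :=
      entropy_eq_of_determines _ _ _ fun ω ω' => by simp [sourceOn_eq_iff]
    rw [h2, c.entropy_source, ← Finset.insert_eq] at h1
    rw [Finset.card_insert_of_notMem ha]
    push_cast
    linarith

theorem entropy_sourceOn_univ : entropy c.p (c.sourceOn Finset.univ) = K * c.Lw := by
  have h : entropy c.p (c.sourceOn Finset.univ) = entropy c.p (fun ω k => c.W k ω) :=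
    entropy_eq_of_determines _ _ _ fun ω ω' => by simp [sourceOn, funext_iff]
  rw [h, c.indep_source]
  simp [c.entropy_source]

/-- The subadditive bounds for S and its complement already sum to the total `K * Lw`, so both are
tight. -/
theorem entropy_sourceOn (S : Finset (Fin K)) :
    entropy c.p (c.sourceOn S) = S.card * c.Lw := by
  refine le_antisymm (c.entropy_sourceOn_le S) ?_
  have h1 := c.entropy_sourceOn_union_le S Sᶜ
  have h2 := c.entropy_sourceOn_le Sᶜ
  rw [Finset.union_compl, entropy_sourceOn_univ] at h1
  have h3 : ((S.card : ℝ) + (Sᶜ.card : ℝ)) = K := by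
    exact_mod_cast (Finset.card_add_card_compl S).trans (Fintype.card_fin K)
  rw [← h3] at h1
  linarith

/-- Given the source symbols in `S`, the coded symbol `X u` reveals nothing about the others. -/
def DependsOnlyOn (u : V) (S : Finset (Fin K)) : Prop :=
  entropy c.p (fun ω => (c.X u ω, c.sourceOn S ω)) + K * c.Lw ≤
    entropy c.p (fun ω => (c.X u ω, c.sourceOn Finset.univ ω)) + S.card * c.Lw

theorem security_entropy {u v : V} (h : G.graph.Adj u v) :
    entropy c.p (fun ω => ((c.X u ω, c.X v ω), c.sourceOn (G.t s(u, v)) ω)) + K * c.Lw =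
      entropy c.p (fun ω => ((c.X u ω, c.X v ω), c.sourceOn Finset.univ ω)) +
        (G.t s(u, v)).card * c.Lw := by
  have h1 := c.security u v h
  rw [condMutualInfo, condEntropy, condEntropy] at h1
  have h2 : entropy c.p (fun ω => ((fun k : ↥((G.t s(u, v))ᶜ) => c.W k ω),
      fun k : ↥(G.t s(u, v)) => c.W k ω)) = entropy c.p (c.sourceOn Finset.univ) := by
    refine entropy_eq_of_determines _ _ _ fun ω ω' => ?_
    simp only [Prod.mk.injEq, sourceOn, funext_iff, Subtype.forall, Finset.mem_compl,
      Finset.mem_univ]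
    grind
  have h3 : entropy c.p (fun ω => ((c.X u ω, c.X v ω), (fun k : ↥((G.t s(u, v))ᶜ) => c.W k ω),
      fun k : ↥(G.t s(u, v)) => c.W k ω)) =
      entropy c.p (fun ω => ((c.X u ω, c.X v ω), c.sourceOn Finset.univ ω)) := by
    refine entropy_eq_of_determines _ _ _ fun ω ω' => ?_
    simp only [Prod.mk.injEq, sourceOn, funext_iff, Subtype.forall, Finset.mem_compl,
      Finset.mem_univ]
    grind
  rw [h2, h3, entropy_sourceOn_univ] at h1
  have h4 := c.entropy_sourceOn (G.t s(u, v))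
  unfold sourceOn at h4 h1 ⊢
  linarith

/-- Security of the pair passes to one of its members by submodularity. -/
theorem dependsOnlyOn_of_adj {u v : V} (h : G.graph.Adj u v) :
    c.DependsOnlyOn u (G.t s(u, v)) := by
  have h1 := c.security_entropy h
  have h2 := entropy_submodular c.p
    (fun ω => ((c.X u ω, c.X v ω), c.sourceOn (G.t s(u, v)) ω))
    (fun ω => (c.X u ω, c.sourceOn Finset.univ ω))
    (fun ω => ((c.X u ω, c.X v ω), c.sourceOn Finset.univ ω))
    (fun ω => (c.X u ω, c.sourceOn (G.t s(u, v)) ω))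
    (by simp only [Prod.mk.injEq, sourceOn_eq_iff]; grind)
    (by simp only [Prod.mk.injEq, sourceOn_eq_iff]; grind)
    (by simp only [Prod.mk.injEq, sourceOn_eq_iff]; grind)
  unfold DependsOnlyOn
  linarith

theorem dependsOnlyOn_univ (u : V) : c.DependsOnlyOn u Finset.univ := by
  simp [DependsOnlyOn]

theorem le_entropy_prodMk_sourceOn (u : V) {S T : Finset (Fin K)} (hST : S ⊆ T) :
    entropy c.p (fun ω => (c.X u ω, c.sourceOn T ω)) + S.card * c.Lw ≤
      entropy c.p (fun ω => (c.X u ω, c.sourceOn S ω)) + T.card * c.Lw := by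
  rw [← entropy_sourceOn, ← entropy_sourceOn]
  refine entropy_submodular c.p _ _ _ _ ?_ ?_ ?_ <;>
    (simp only [Prod.mk.injEq, sourceOn_eq_iff]; grind)

-- Submodularity applies to the joint entropies with X_u, while the entropies of the sources
-- themselves are modular in the index set.
variable {c} in
theorem DependsOnlyOn.inter {u : V} {S T : Finset (Fin K)} (hS : c.DependsOnlyOn u S)
    (hT : c.DependsOnlyOn u T) : c.DependsOnlyOn u (S ∩ T) := by
  have h1 := entropy_submodular c.p
    (fun ω => (c.X u ω, c.sourceOn S ω)) (fun ω => (c.X u ω, c.sourceOn T ω))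
    (fun ω => (c.X u ω, c.sourceOn (S ∪ T) ω)) (fun ω => (c.X u ω, c.sourceOn (S ∩ T) ω))
    (by simp only [Prod.mk.injEq, sourceOn_eq_iff]; grind)
    (by simp only [Prod.mk.injEq, sourceOn_eq_iff]; grind)
    (by simp only [Prod.mk.injEq, sourceOn_eq_iff]; grind)
  have h2 := c.le_entropy_prodMk_sourceOn u (Finset.subset_univ (S ∪ T))
  have h3 : ((S ∪ T).card : ℝ) * c.Lw + (S ∩ T).card * c.Lw = S.card * c.Lw + T.card * c.Lw := by
    rw [← add_mul, ← add_mul]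
    exact_mod_cast congrArg (fun n : ℕ => (n : ℝ) * c.Lw) (Finset.card_union_add_card_inter S T)
  rw [Finset.card_univ, Fintype.card_fin] at h2
  unfold DependsOnlyOn at *
  linarith

/-- A coded symbol whose node has no common source is independent of the source symbols. -/
theorem entropy_prodMk_sourceOn [Finite V] {u : V} (hu : G.commonSources u = ∅)
    (S : Finset (Fin K)) : entropy c.p (fun ω => (c.X u ω, c.sourceOn S ω)) =
      entropy c.p (c.X u) + S.card * c.Lw := by
  classical
  have := Fintype.ofFinite V
  -- Intersect the labels one neighbour at a time; the empty infimum is the set of all sources. Over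
  -- all neighbours it becomes the set of common sources.
  have key : ∀ N : Finset V, (∀ v ∈ N, G.graph.Adj u v) →
      c.DependsOnlyOn u (N.inf fun v => G.t s(u, v)) := by
    intro N
    induction N using Finset.induction_on with
    | empty => exact fun _ => c.dependsOnlyOn_univ u
    | insert a N ha ih =>
      intro hN
      rw [Finset.inf_insert]
      exact (c.dependsOnlyOn_of_adj (hN a (by simp))).inter
        (ih fun v hv => hN v (Finset.mem_insert_of_mem hv))
  have h1 := key {v | G.graph.Adj u v} (by simp)
  have h2 : (Finset.inf {v | G.graph.Adj u v} fun v => G.t s(u, v)) = ∅ := by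
    refine Finset.eq_empty_of_forall_notMem fun k hk => ?_
    have : k ∈ G.commonSources u := by
      simp only [commonSources, Set.mem_iInter]
      intro v hv
      exact Finset.inf_le (f := fun v => G.t s(u, v)) (by simpa using hv) hk
    simp [hu] at this
  rw [h2] at h1
  have h3 := c.le_entropy_prodMk_sourceOn u (Finset.subset_univ S)
  have h4 : entropy c.p (fun ω => (c.X u ω, c.sourceOn ∅ ω)) = entropy c.p (c.X u) :=
    entropy_eq_of_determines _ _ _ fun ω ω' => by simp [sourceOn_eq_iff]
  have h5 := entropy_prodMk_le c.p (c.X u) (c.sourceOn S)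
  rw [c.entropy_sourceOn] at h5
  rw [DependsOnlyOn, h4] at h1
  simp only [Finset.card_univ, Fintype.card_fin, Finset.card_empty, Nat.cast_zero, zero_mul,
    add_zero] at h1 h3
  linarith

/-- The uncertainty about `X v` left by `X u` and the source symbols in `S`. -/
noncomputable def gap (S : Finset (Fin K)) (u v : V) : ℝ :=
  condEntropy c.p (c.X v) (fun ω => (c.X u ω, c.sourceOn S ω))

theorem gap_self (S : Finset (Fin K)) (u : V) : c.gap S u u = 0 := by
  refine sub_eq_zero.2 (entropy_eq_of_determines _ _ _ fun ω ω' => ?_)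
  simp +contextual

theorem gap_triangle (S : Finset (Fin K)) (u v w : V) :
    c.gap S u w ≤ c.gap S u v + c.gap S v w := by
  have h1 := entropy_submodular c.p
    (fun ω => (c.X v ω, (c.X u ω, c.sourceOn S ω))) (fun ω => (c.X w ω, (c.X v ω, c.sourceOn S ω)))
    (fun ω => (c.X w ω, (c.X u ω, c.sourceOn S ω))) (fun ω => (c.X v ω, c.sourceOn S ω))
    (by simp only [Prod.mk.injEq]; grind) (by simp only [Prod.mk.injEq]; grind)
    (by simp only [Prod.mk.injEq]; grind)
  unfold gap condEntropy
  linarith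

theorem gap_anti {S T : Finset (Fin K)} (hST : S ⊆ T) (u v : V) : c.gap T u v ≤ c.gap S u v := by
  have h1 := entropy_submodular c.p
    (fun ω => (c.X u ω, c.sourceOn T ω)) (fun ω => (c.X v ω, (c.X u ω, c.sourceOn S ω)))
    (fun ω => (c.X v ω, (c.X u ω, c.sourceOn T ω))) (fun ω => (c.X u ω, c.sourceOn S ω))
    (by simp only [Prod.mk.injEq, sourceOn_eq_iff]; grind)
    (by simp only [Prod.mk.injEq, sourceOn_eq_iff]; grind)
    (by simp only [Prod.mk.injEq, sourceOn_eq_iff]; grind)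
  unfold gap condEntropy
  linarith

theorem gap_nonneg (S : Finset (Fin K)) (u v : V) : 0 ≤ c.gap S u v :=
  sub_nonneg.2 (entropy_le_of_determines _ _ _ fun ω ω' => by simp)

/-- The amount by which the coded symbols exceed the smallest possible size. -/
noncomputable def excess : ℝ := c.Lv - D * c.Lw

theorem entropy_le_Lv (v : V) : entropy c.p (c.X v) ≤ c.Lv := by
  have : Nonempty c.B := Fintype.card_pos_iff.1 (zero_lt_one.trans c.one_lt_card)
  exact entropy_le_logb_card c.p (c.X v)

/-- Decoded sources may be adjoined to the pair (X_u, X_v) at no entropy cost. -/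
theorem correctness_entropy {u v : V} (h : G.graph.Adj u v) (S : Finset (Fin K)) :
    entropy c.p (fun ω => (c.X v ω, (c.X u ω, c.sourceOn (G.t s(u, v) ∪ S) ω))) =
      entropy c.p (fun ω => (c.X v ω, (c.X u ω, c.sourceOn S ω))) := by
  have h1 := c.correctness u v h
  rw [condEntropy] at h1
  have h2 := entropy_submodular c.p
    (fun ω => ((fun k : ↥(G.t s(u, v)) => c.W k ω), (c.X u ω, c.X v ω)))
    (fun ω => (c.X v ω, (c.X u ω, c.sourceOn S ω)))
    (fun ω => (c.X v ω, (c.X u ω, c.sourceOn (G.t s(u, v) ∪ S) ω)))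
    (fun ω => (c.X u ω, c.X v ω))
    (by simp only [Prod.mk.injEq, sourceOn, funext_iff, Subtype.forall]; grind)
    (by simp only [Prod.mk.injEq]; grind)
    (by simp only [Prod.mk.injEq]; grind)
  have h3 := entropy_le_of_determines c.p
    (fun ω => (c.X v ω, (c.X u ω, c.sourceOn (G.t s(u, v) ∪ S) ω)))
    (fun ω => (c.X v ω, (c.X u ω, c.sourceOn S ω)))
    (by simp only [Prod.mk.injEq, sourceOn_eq_iff]; grind)
  linarith

/-- The pair (X_u, X_v) has entropy at most H(X_u) + `Lv` and also determines the label's sources,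
whose `D * Lw` bits are independent of X_u. -/
theorem gap_le_excess [Finite V] {u v : V} (hu : G.commonSources u = ∅)
    (h : G.graph.Adj u v) (hq : G.t s(u, v) ≠ ∅) : c.gap (G.t s(u, v)) u v ≤ c.excess := by
  have h1 := c.correctness_entropy h ∅
  rw [Finset.union_empty] at h1
  have h2 : entropy c.p (fun ω => (c.X v ω, (c.X u ω, c.sourceOn ∅ ω))) =
      entropy c.p (fun ω => (c.X v ω, c.X u ω)) :=
    entropy_eq_of_determines _ _ _ fun ω ω' => by simp [sourceOn_eq_iff]
  have h3 := entropy_prodMk_le c.p (c.X v) (c.X u)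
  have h4 := c.entropy_le_Lv v
  have h5 := c.entropy_prodMk_sourceOn hu (G.t s(u, v))
  rw [(G.card_t s(u, v) h).resolve_right hq] at h5
  unfold gap condEntropy excess
  linarith

/-- Both X_u and the pair (X_u, X_v) are independent of all sources, so conditioning on the sources
does not lower H(X_v | X_u). -/
theorem gap_empty_le [Finite V] {u v : V} (hu : G.commonSources u = ∅)
    (h : G.graph.Adj u v) (hq : G.t s(u, v) = ∅) : c.gap ∅ u v ≤ c.gap Finset.univ u v := by
  have h1 := c.security_entropy h
  rw [hq] at h1
  have h2 := c.entropy_prodMk_sourceOn hu Finset.univ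
  have h3 := c.entropy_prodMk_sourceOn hu ∅
  have h4 : ∀ S, entropy c.p (fun ω => ((c.X u ω, c.X v ω), c.sourceOn S ω)) =
      entropy c.p (fun ω => (c.X v ω, (c.X u ω, c.sourceOn S ω))) := fun S =>
    entropy_eq_of_determines _ _ _ fun ω ω' => by simp only [Prod.mk.injEq]; grind
  rw [h4, h4] at h1
  simp only [Finset.card_univ, Fintype.card_fin, Finset.card_empty, Nat.cast_zero, zero_mul,
    add_zero] at h1 h2 h3
  unfold gap condEntropy
  linarith

/-- Given X_u and the other sources, W_k keeps its full entropy, yet X_v then reveals it. -/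
theorem Lw_le_gap [Finite V] {u v : V} (hu : G.commonSources u = ∅)
    (h : G.graph.Adj u v) {k : Fin K} (hk : k ∈ G.t s(u, v)) :
    c.Lw ≤ c.gap (Finset.univ.erase k) u v := by
  have h1 := c.correctness_entropy h (Finset.univ.erase k)
  have h2 := c.entropy_prodMk_sourceOn hu Finset.univ
  have h3 := c.entropy_prodMk_sourceOn hu (Finset.univ.erase k)
  have h4 := entropy_le_of_determines c.p
    (fun ω => (c.X v ω, (c.X u ω, c.sourceOn (G.t s(u, v) ∪ Finset.univ.erase k) ω)))
    (fun ω => (c.X u ω, c.sourceOn Finset.univ ω))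
    (by simp only [Prod.mk.injEq, sourceOn_eq_iff]; grind)
  have h5 : (((Finset.univ.erase k).card : ℝ) + 1) * c.Lw =
      (Finset.univ : Finset (Fin K)).card * c.Lw := by
    exact_mod_cast congrArg (fun n : ℕ => (n : ℝ) * c.Lw)
      (Finset.card_erase_add_one (Finset.mem_univ k))
  unfold gap condEntropy
  linarith

theorem Lv_pos : 0 < c.Lv :=
  Real.logb_pos one_lt_two (by exact_mod_cast c.one_lt_card)

end SecureStorageCode

end StorageGraph

/-! ### Internal qualified edges keep the capacity below `1 / D` -/

namespace StorageGraph

variable {V : Type*} {K D : ℕ} (G : StorageGraph V K D)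

theorem exists_qualified_edge {u : V} (hu : u ∈ G.nonDegenerateNodes)
    (hC : G.commonSources u = ∅) : ∃ v, G.graph.Adj u v ∧ G.t s(u, v) ≠ ∅ := by
  by_contra! h
  exact hu fun v hv => by rw [hC, h v hv, Finset.coe_empty]

theorem pos_of_qualified_edge {u v : V} (h : G.graph.Adj u v) (hq : G.t s(u, v) ≠ ∅) : 0 < D := by
  rw [← (G.card_t s(u, v) h).resolve_right hq]
  exact Finset.card_pos.2 (Finset.nonempty_iff_ne_empty.2 hq)

variable {G}

theorem SecureStorageCode.excess_nonneg [Finite V] (c : G.SecureStorageCode) {u v : V}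
    (hu : G.commonSources u = ∅) (h : G.graph.Adj u v) (hq : G.t s(u, v) ≠ ∅) : 0 ≤ c.excess :=
  (c.gap_nonneg _ _ _).trans (c.gap_le_excess hu h hq)

variable (G)

theorem capacity_le [Finite V] {u v : V}
    (hu : G.commonSources u = ∅) (h : G.graph.Adj u v) (hq : G.t s(u, v) ≠ ∅) :
    G.capacity ≤ ((1 / (D : ℝ) : ℝ) : EReal) := by
  refine iSup_le fun c => EReal.coe_le_coe_iff.2 ?_
  have hD : (0 : ℝ) < D := by exact_mod_cast G.pos_of_qualified_edge h hq
  have h1 := c.excess_nonneg hu h hq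
  rw [SecureStorageCode.excess] at h1
  rw [SecureStorageCode.rate, div_le_div_iff₀ c.Lv_pos hD]
  linarith

theorem nonDegenerateSubgraph_charGraph_adj {Q : Set G.nonDegenerateNodes} {k : Fin K} {u v : Q}
    (h : ((G.nonDegenerateSubgraph.induce Q).charGraph k).unqualifiedGraph.Adj u v) :
    G.graph.Adj u v ∧ k ∉ G.t s((u : V), (v : V)) := by
  refine ⟨h.1, fun hk => ?_⟩
  have h2 : (if k ∈ G.t s((u : V), (v : V)) then ({k} : Finset (Fin K)) else ∅) = ∅ := h.2
  simp [hk] at h2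

theorem nonDegenerateSubgraph_charGraph_adj_of_mem {Q : Set G.nonDegenerateNodes} {k : Fin K}
    {u v : Q} (h : ((G.nonDegenerateSubgraph.induce Q).charGraph k).qualifiedGraph.Adj u v) :
    G.graph.Adj u v ∧ k ∈ G.t s((u : V), (v : V)) := by
  refine ⟨h.1, ?_⟩
  have h2 : (if k ∈ G.t s((u : V), (v : V)) then ({k} : Finset (Fin K)) else ∅) ≠ ∅ := h.2
  by_contra hk
  simp [hk] at h2

variable [Finite V] (hC : ∀ v ∈ G.nonDegenerateNodes, G.commonSources v = ∅)

include hC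

/-- N is chosen before the code; this uniformity is what later yields a strict bound on the
supremum. -/
theorem exists_gap_univ_le {Q : Set G.nonDegenerateNodes} {u v : Q}
    (p : (G.nonDegenerateSubgraph.induce Q).qualifiedGraph.Walk u v) :
    ∃ N : ℕ, ∀ c : G.SecureStorageCode, c.gap Finset.univ (u : V) (v : V) ≤ N * c.excess := by
  induction p with
  | nil => exact ⟨0, fun c => by simp [c.gap_self]⟩
  | @cons u v w h p ih =>
    obtain ⟨N, hN⟩ := ih
    refine ⟨N + 1, fun c => ?_⟩
    have h1 := c.gap_triangle Finset.univ (u : V) (v : V) (w : V)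
    have h2 := (c.gap_anti (Finset.subset_univ _) (u : V) (v : V)).trans
      (c.gap_le_excess (hC _ u.1.2) h.1 h.2)
    have h3 := hN c
    push_cast
    linarith

theorem exists_gap_erase_le {Q : Set G.nonDegenerateNodes}
    (hQ : (G.nonDegenerateSubgraph.induce Q).qualifiedGraph.Connected) {k : Fin K} {u v : Q}
    (p : ((G.nonDegenerateSubgraph.induce Q).charGraph k).unqualifiedGraph.Walk u v) :
    ∃ N : ℕ, ∀ c : G.SecureStorageCode,
      c.gap (Finset.univ.erase k) (u : V) (v : V) ≤ N * c.excess := by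
  induction p with
  | nil => exact ⟨0, fun c => by simp [c.gap_self]⟩
  | @cons u v w h p ih =>
    obtain ⟨N, hN⟩ := ih
    obtain ⟨hadj, hk⟩ := G.nonDegenerateSubgraph_charGraph_adj h
    have hu := hC _ u.1.2
    obtain ⟨M, hM⟩ : ∃ M : ℕ, ∀ c : G.SecureStorageCode,
        c.gap (Finset.univ.erase k) (u : V) (v : V) ≤ M * c.excess := by
      by_cases ht : G.t s((u : V), (v : V)) = ∅
      -- The detour through a qualified path is the reason for working inside one qualified
      -- component.
      · obtain ⟨M, hM⟩ := G.exists_gap_univ_le hC (hQ.preconnected u v).some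
        exact ⟨M, fun c => ((c.gap_anti (Finset.empty_subset _) _ _).trans
          (c.gap_empty_le hu hadj ht)).trans (hM c)⟩
      · refine ⟨1, fun c => (c.gap_anti (fun j hj => ?_) _ _).trans
          ((c.gap_le_excess hu hadj ht).trans (by simp))⟩
        exact Finset.mem_erase.2 ⟨fun h => hk (h ▸ hj), Finset.mem_univ j⟩
    refine ⟨M + N, fun c => ?_⟩
    have h1 := c.gap_triangle (Finset.univ.erase k) (u : V) (v : V) (w : V)
    have h2 := hM c
    have h3 := hN c
    push_cast
    linarith

theorem capacity_lt_of_hasInternalQualifiedEdge {Q : Set G.nonDegenerateNodes}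
    (hQ : (G.nonDegenerateSubgraph.induce Q).qualifiedGraph.Connected) {k : Fin K}
    (hk : ((G.nonDegenerateSubgraph.induce Q).charGraph k).HasInternalQualifiedEdge) :
    G.capacity < ((1 / (D : ℝ) : ℝ) : EReal) := by
  classical
  obtain ⟨u, v, huv, a, b, p, hu, hv⟩ := hk
  obtain ⟨hadj, hkt⟩ := G.nonDegenerateSubgraph_charGraph_adj_of_mem huv
  have hne : G.t s((u : V), (v : V)) ≠ ∅ := Finset.ne_empty_of_mem hkt
  obtain ⟨N, hN⟩ := G.exists_gap_erase_le hC hQ ((p.takeUntil u hu).reverse.append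
    (p.takeUntil v hv))
  have hD : (0 : ℝ) < D := by exact_mod_cast G.pos_of_qualified_edge hadj hne
  -- The bound results from solving `Lw ≤ (N + 1) * (Lv - D * Lw)` for the rate.
  refine lt_of_le_of_lt (b := ((((N : ℝ) + 1) / (D * (N + 1) + 1) : ℝ) : EReal)) ?_ ?_
  · refine iSup_le fun c => EReal.coe_le_coe_iff.2 ?_
    have h1 := (c.Lw_le_gap (hC _ u.1.2) hadj hkt).trans (hN c)
    have h2 := c.excess_nonneg (hC _ u.1.2) hadj hne
    rw [SecureStorageCode.rate, div_le_div_iff₀ c.Lv_pos (by positivity)]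
    rw [SecureStorageCode.excess] at h1 h2
    nlinarith
  · refine EReal.coe_lt_coe_iff.2 ?_
    rw [div_lt_div_iff₀ (by positivity) hD]
    linarith

end StorageGraph

/-! ### Linear codes over a finite field -/

section Uniform

variable {Ω S T R U : Type*} [Fintype Ω] [Fintype S] [Fintype T] [Fintype R] [Fintype U]

/-- Translation by a preimage of t - s carries the fibre over s to the fibre over t, so the image
law is uniform. -/
theorem entropy_uniformOfFintype_of_surjective [AddCommGroup Ω] [AddCommGroup S] (f : Ω → S)
    (hadd : ∀ a b, f (a + b) = f a + f b) (hf : Function.Surjective f) :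
    entropy (PMF.uniformOfFintype Ω) f = Real.logb 2 (Fintype.card S) := by
  classical
  set p := PMF.uniformOfFintype Ω
  have h2 : Real.log 2 ≠ 0 := (Real.log_pos one_lt_two).ne'
  have hconst : ∀ s t, ((p.map f) s).toReal = ((p.map f) t).toReal := by
    intro s t
    obtain ⟨a, ha⟩ := hf (t - s)
    rw [toReal_map_apply, toReal_map_apply]
    refine Fintype.sum_equiv (Equiv.addRight a) _ _ fun ω => ?_
    have : f ω = s ↔ f (ω + a) = t := by rw [hadd, ha, add_sub, sub_eq_iff_eq_add,
      add_comm t s, add_left_inj]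
    simp [p, this]
  have hval : ∀ s, ((p.map f) s).toReal = (Fintype.card S : ℝ)⁻¹ := by
    intro s
    have h := sum_toReal_map p f
    rw [Finset.sum_congr rfl fun t _ => hconst t s, Finset.sum_const, nsmul_eq_mul,
      Finset.card_univ] at h
    exact eq_inv_of_mul_eq_one_right h
  have h := entropy_mul_log_two p f
  simp_rw [hval] at h
  rw [← Finset.sum_mul, sum_toReal_pmf, one_mul, Real.log_inv, neg_neg] at h
  rw [Real.logb, eq_div_iff h2, h]

variable (p : PMF Ω)

/-- Given Z, the variable X is a function of the noise N, which is independent of (Y, Z). -/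
theorem condMutualInfo_eq_zero_of_independent_noise (X : Ω → S) (Y : Ω → T) (Z : Ω → R)
    (N : Ω → U) (hN : entropy p N + entropy p (fun ω => (Y ω, Z ω)) ≤
      entropy p (fun ω => (N ω, (Y ω, Z ω))))
    (hX : ∀ ω ω', N ω = N ω' → Z ω = Z ω' → X ω = X ω') : condMutualInfo p X Y Z = 0 := by
  have h1 := entropy_submodular p (fun ω => (X ω, (Y ω, Z ω))) (fun ω => (N ω, Z ω))
    (fun ω => (N ω, (Y ω, Z ω))) (fun ω => (X ω, Z ω))
    (by simp only [Prod.mk.injEq]; grind) (by simp only [Prod.mk.injEq]; grind)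
    (by simp only [Prod.mk.injEq]; grind)
  have h2 := entropy_prodMk_le p N Z
  have h3 := entropy_submodular p (fun ω => (Y ω, Z ω)) (fun ω => (X ω, Z ω))
    (fun ω => (X ω, (Y ω, Z ω))) Z
    (by simp only [Prod.mk.injEq]; grind) (by simp only [Prod.mk.injEq]; grind)
    (by simp only [Prod.mk.injEq]; grind)
  unfold condMutualInfo condEntropy
  linarith

end Uniform

/-! ### Vandermonde mixing of the source symbols -/

section Mix

variable {F : Type*} [Field F] {K D : ℕ} (y : Fin K → F)

/-- `∑ k, x k * w k * (1, y k, y k ^ 2, …)`, a vector of length `D`. -/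
def vandermondeMix (D : ℕ) (x w : Fin K → F) : Fin D → F := fun i => ∑ k, x k * w k * y k ^ (i : ℕ)

theorem vandermondeMix_add (x w w' : Fin K → F) :
    vandermondeMix y D x (w + w') = vandermondeMix y D x w + vandermondeMix y D x w' := by
  ext i
  simp only [vandermondeMix, Pi.add_apply, ← Finset.sum_add_distrib]
  exact Finset.sum_congr rfl fun k _ => by ring

theorem vandermondeMix_sub_left (x x' w : Fin K → F) :
    vandermondeMix y D (x - x') w = vandermondeMix y D x w - vandermondeMix y D x' w := by
  ext i
  simp only [vandermondeMix, Pi.sub_apply, ← Finset.sum_sub_distrib]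
  exact Finset.sum_congr rfl fun k _ => by ring

theorem vandermondeMix_congr {x w w' : Fin K → F} (h : ∀ k, x k ≠ 0 → w k = w' k) :
    vandermondeMix y D x w = vandermondeMix y D x w' := by
  ext i
  refine Finset.sum_congr rfl fun k _ => ?_
  by_cases hk : x k = 0
  · simp [hk]
  · rw [h k hk]

theorem eq_of_vandermondeMix_eq (hy : Function.Injective y) {x w w' : Fin K → F}
    {t : Finset (Fin K)} (ht : t.card = D ∨ t = ∅) (hx : ∀ k, x k ≠ 0 ↔ k ∈ t)
    (h : vandermondeMix y D x w = vandermondeMix y D x w') : ∀ k ∈ t, w k = w' k := by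
  rcases ht with ht | rfl
  · subst ht
    -- The unknowns are x_k (w_k - w'_k) for k in t: as many as the equations, with distinct nodes
    -- y_k.
    have key := Matrix.eq_zero_of_forall_pow_sum_mul_pow_eq_zero
      (f := fun j => y (t.equivFin.symm j))
      (v := fun j => x (t.equivFin.symm j) * (w (t.equivFin.symm j) - w' (t.equivFin.symm j)))
      (hy.comp (Subtype.val_injective.comp t.equivFin.symm.injective)) (fun i => ?_)
    · intro k hk
      have h1 := congrFun key (t.equivFin ⟨k, hk⟩)
      simp only [Equiv.symm_apply_apply, Pi.zero_apply] at h1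
      exact sub_eq_zero.1 ((mul_eq_zero.1 h1).resolve_left ((hx k).2 hk))
    · have h1 := congrFun h i
      simp only [vandermondeMix] at h1
      rw [← sub_eq_zero, ← Finset.sum_sub_distrib,
        ← Finset.sum_subset (Finset.subset_univ t) fun k _ hk => by
          rw [not_not.1 (mt (hx k).1 hk)]; ring] at h1
      rw [t.equivFin.symm.sum_comp fun k : t => x k * (w k - w' k) * y k ^ (i : ℕ),
        Finset.sum_coe_sort t fun k => x k * (w k - w' k) * y k ^ (i : ℕ), ← h1]
      exact Finset.sum_congr rfl fun k _ => by ring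
  · simp

end Mix

/-! ### Linear codes with shared noise: decoding and security -/

namespace StorageGraph

variable {V : Type*} {K D m : ℕ} (G : StorageGraph V K D) {F : Type} [Field F] [Fintype F]
  (y : Fin K → F) (n : V → Option (Fin m)) (x : V → Fin K → F)

/-- The coded symbol of a node with noise index `n v` and source coefficients `x v`. -/
def linearCode (v : V) (ω : (Fin K → F) × (Fin m → Fin D → F)) : Fin D → F :=
  (n v).elim 0 ω.2 + vandermondeMix y D (x v) ω.1

omit [Fintype F] in
theorem linearCode_add (v : V) (ω ω' : (Fin K → F) × (Fin m → Fin D → F)) :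
    linearCode y n x v (ω + ω') = linearCode y n x v ω + linearCode y n x v ω' := by
  unfold linearCode
  rw [Prod.fst_add, vandermondeMix_add]
  cases n v
  · simp
  · simp only [Option.elim_some, Prod.snd_add, Pi.add_apply]
    abel

/-- The requirements on noise indices and source coefficients at an edge associated with `t`. -/
def IsLinearScheme (u v : V) (t : Finset (Fin K)) : Prop :=
  match n u, n v with
  | some i, some j => if i = j then ∀ k, (x u - x v) k ≠ 0 ↔ k ∈ t else t = ∅
  | some _, none => ∀ k, x v k ≠ 0 ↔ k ∈ t
  | none, some _ => ∀ k, x u k ≠ 0 ↔ k ∈ t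
  | none, none => (∀ k, x u k ≠ 0 ↔ k ∈ t) ∧ ∀ k, x v k ≠ 0 ↔ k ∈ t

variable {n x}

-- With a shared noise index, subtracting the two coded symbols cancels the noise and leaves a mix
-- with coefficients `x u - x v`; a noiseless end is decoded by itself.
omit [Fintype F] in
theorem IsLinearScheme.eq_of_linearCode_eq {u v : V} {t : Finset (Fin K)}
    (h : IsLinearScheme n x u v t) (hy : Function.Injective y) (ht : t.card = D ∨ t = ∅)
    {ω ω' : (Fin K → F) × (Fin m → Fin D → F)} (hu : linearCode y n x u ω = linearCode y n x u ω')
    (hv : linearCode y n x v ω = linearCode y n x v ω') : ∀ k ∈ t, ω.1 k = ω'.1 k := by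
  unfold IsLinearScheme at h
  unfold linearCode at hu hv
  rcases hnu : n u with _ | i <;> rcases hnv : n v with _ | j <;>
    simp only [hnu, hnv, Option.elim_none, Option.elim_some, zero_add] at h hu hv
  · exact eq_of_vandermondeMix_eq y hy ht h.1 hu
  · exact eq_of_vandermondeMix_eq y hy ht h hu
  · exact eq_of_vandermondeMix_eq y hy ht h hv
  · split_ifs at h with hij
    · subst hij
      refine eq_of_vandermondeMix_eq y hy ht h ?_
      rw [vandermondeMix_sub_left, vandermondeMix_sub_left,
        ← add_sub_add_left_eq_sub _ _ (ω.2 i), hu, hv, add_sub_add_left_eq_sub]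
    · simp [h]

theorem entropy_add_le_of_surjective {Ω S T : Type*} [Fintype Ω] [Fintype S] [Fintype T]
    [AddCommGroup Ω] [AddCommGroup S] [AddCommGroup T] {f : Ω → S} {g : Ω → T}
    (hf : ∀ a b, f (a + b) = f a + f b) (hg : ∀ a b, g (a + b) = g a + g b)
    (h : ∀ s t, ∃ ω, f ω = s ∧ g ω = t) :
    entropy (PMF.uniformOfFintype Ω) f + entropy (PMF.uniformOfFintype Ω) g ≤
      entropy (PMF.uniformOfFintype Ω) (fun ω => (f ω, g ω)) := by
  have h1 := entropy_uniformOfFintype_of_surjective (fun ω => (f ω, g ω))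
    (fun a b => Prod.ext (hf a b) (hg a b)) (fun s => by
      obtain ⟨ω, h1, h2⟩ := h s.1 s.2
      exact ⟨ω, Prod.ext h1 h2⟩)
  refine le_of_le_of_eq (add_le_add (entropy_le_logb_card _ f) (entropy_le_logb_card _ g))
    (Eq.trans ?_ h1.symm)
  rw [Fintype.card_prod, Nat.cast_mul, Real.logb_mul] <;>
    exact_mod_cast Fintype.card_ne_zero

/-- N is onto for every fixed value of the sources, hence jointly uniform with them and independent
of them. -/
theorem condMutualInfo_source_eq_zero {S U : Type*} [Fintype S] [Fintype U] [AddCommGroup U]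
    (X : (Fin K → F) × (Fin m → Fin D → F) → S) (N : (Fin K → F) × (Fin m → Fin D → F) → U)
    (t : Finset (Fin K)) (hadd : ∀ a b, N (a + b) = N a + N b) (hN : ∀ s w, ∃ z, N (w, z) = s)
    (hX : ∀ ω ω', N ω = N ω' → (∀ k ∈ t, ω.1 k = ω'.1 k) → X ω = X ω') :
    condMutualInfo (PMF.uniformOfFintype _) X (fun ω (k : ↥(tᶜ)) => ω.1 k)
      (fun ω (k : ↥t) => ω.1 k) = 0 := by
  refine condMutualInfo_eq_zero_of_independent_noise _ X _ _ N ?_ ?_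
  · have h1 := entropy_add_le_of_surjective (f := N)
      (g := (Prod.fst : (Fin K → F) × (Fin m → Fin D → F) → Fin K → F)) hadd (fun _ _ => rfl)
      fun s w => (hN s w).imp' (fun z => (w, z)) fun z hz => ⟨hz, rfl⟩
    refine le_trans (le_trans (add_le_add_right ?_ _) h1) ?_
    · refine entropy_le_of_determines _ _ _ fun ω ω' h => ?_
      rw [h]
    · refine entropy_le_of_determines _ _ _ fun ω ω' h => ?_
      simp only [Prod.mk.injEq, funext_iff, Subtype.forall, Finset.mem_compl] at h ⊢
      grind
  · intro ω ω' h1 h2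
    exact hX ω ω' h1 fun k hk => congrFun h2 ⟨k, hk⟩

omit [Fintype F] in
theorem exists_linearCode_eq (x : V → Fin K → F) {u : V} {i : Fin m} (hu : n u = some i)
    (s : Fin D → F) (w : Fin K → F) : ∃ z, linearCode y n x u (w, z) = s :=
  ⟨fun _ => s - vandermondeMix y D (x u) w, by simp [linearCode, hu]⟩

theorem IsLinearScheme.condMutualInfo_eq_zero {u v : V} {t : Finset (Fin K)}
    (h : IsLinearScheme n x u v t) :
    condMutualInfo (PMF.uniformOfFintype ((Fin K → F) × (Fin m → Fin D → F)))
      (fun ω => (linearCode y n x u ω, linearCode y n x v ω)) (fun ω (k : ↥(tᶜ)) => ω.1 k)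
      (fun ω (k : ↥t) => ω.1 k) = 0 := by
  unfold IsLinearScheme at h
  rcases hnu : n u with _ | i <;> rcases hnv : n v with _ | j <;> simp only [hnu, hnv] at h
  -- Without noise at either end the trivial group serves as N: both coded symbols are functions of
  -- the sources in t.
  · refine condMutualInfo_source_eq_zero _ (fun _ => (0 : ZMod 1)) t (by simp)
      (fun s w => ⟨0, Subsingleton.elim _ _⟩) fun ω ω' _ ht => ?_
    simp only [linearCode, hnu, hnv, Option.elim_none]
    rw [vandermondeMix_congr y fun k hk => ht k ((h.1 k).1 hk),
      vandermondeMix_congr y fun k hk => ht k ((h.2 k).1 hk)]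
  · refine condMutualInfo_source_eq_zero _ (linearCode y n x v) t (linearCode_add y n x v)
      (exists_linearCode_eq y x hnv) fun ω ω' hN ht => Prod.ext ?_ hN
    simp only [linearCode, hnu, Option.elim_none]
    rw [vandermondeMix_congr y fun k hk => ht k ((h k).1 hk)]
  · refine condMutualInfo_source_eq_zero _ (linearCode y n x u) t (linearCode_add y n x u)
      (exists_linearCode_eq y x hnu) fun ω ω' hN ht => Prod.ext hN ?_
    simp only [linearCode, hnv, Option.elim_none]
    rw [vandermondeMix_congr y fun k hk => ht k ((h k).1 hk)]
  · split_ifs at h with hij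
    · subst hij
      refine condMutualInfo_source_eq_zero _ (linearCode y n x u) t (linearCode_add y n x u)
        (exists_linearCode_eq y x hnu) fun ω ω' hN ht => Prod.ext hN ?_
      have h1 := vandermondeMix_congr (D := D) y fun k hk => ht k ((h k).1 hk)
      rw [vandermondeMix_sub_left, vandermondeMix_sub_left] at h1
      simp only [linearCode, hnu, hnv, Option.elim_some] at hN ⊢
      linear_combination hN - h1
    -- With distinct noise indices the pair of coded symbols is itself the noise.
    · refine condMutualInfo_source_eq_zero _
        (fun ω => (linearCode y n x u ω, linearCode y n x v ω)) t
        (fun a b => Prod.ext (linearCode_add y n x u a b) (linearCode_add y n x v a b))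
        (fun s w => ⟨fun l => if l = i then s.1 - vandermondeMix y D (x u) w else
          s.2 - vandermondeMix y D (x v) w, ?_⟩) fun ω ω' hN _ => hN
      simp [linearCode, hnu, hnv, Ne.symm hij]

theorem entropy_source_symbol (k : Fin K) :
    entropy (PMF.uniformOfFintype ((Fin K → F) × (Fin m → Fin D → F))) (fun ω => ω.1 k) =
      Real.logb 2 (Fintype.card F) :=
  entropy_uniformOfFintype_of_surjective _ (fun _ _ => rfl)
    fun s => ⟨(fun _ => s, 0), rfl⟩

theorem entropy_source_symbols :
    entropy (PMF.uniformOfFintype ((Fin K → F) × (Fin m → Fin D → F))) (fun ω k => ω.1 k) =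
      ∑ k : Fin K, entropy (PMF.uniformOfFintype ((Fin K → F) × (Fin m → Fin D → F)))
        (fun ω => ω.1 k) := by
  rw [entropy_uniformOfFintype_of_surjective _ (fun _ _ => rfl) fun s => ⟨(s, 0), rfl⟩,
    Finset.sum_congr rfl fun k _ => entropy_source_symbol k]
  simp [Real.logb_pow]

/-- The secure storage code given by a linear scheme. -/
noncomputable def linearStorageCode (hD : 0 < D) (hy : Function.Injective y)
    (h : ∀ u v, G.graph.Adj u v → IsLinearScheme n x u v (G.t s(u, v))) :
    G.SecureStorageCode where
  Ω := (Fin K → F) × (Fin m → Fin D → F)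
  A := F
  B := Fin D → F
  p := PMF.uniformOfFintype _
  W k ω := ω.1 k
  X := linearCode y n x
  Lw := Real.logb 2 (Fintype.card F)
  Lw_pos := Real.logb_pos one_lt_two (by exact_mod_cast Fintype.one_lt_card)
  one_lt_card := by
    have : Nonempty (Fin D) := ⟨⟨0, hD⟩⟩
    exact Fintype.one_lt_card
  entropy_source := entropy_source_symbol
  indep_source := entropy_source_symbols
  correctness u v huv := by
    refine sub_eq_zero.2 (entropy_eq_of_determines _ _ _ fun ω ω' => ⟨fun h1 => ?_, fun h1 => ?_⟩)
    · exact (Prod.mk.inj h1).2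
    · refine Prod.ext (funext fun k => ?_) h1
      exact (h u v huv).eq_of_linearCode_eq y hy (G.card_t _ huv) (Prod.mk.inj h1).1
        (Prod.mk.inj h1).2 k k.2
  security u v huv := (h u v huv).condMutualInfo_eq_zero y

theorem rate_linearStorageCode (hD : 0 < D) (hy : Function.Injective y)
    (h : ∀ u v, G.graph.Adj u v → IsLinearScheme n x u v (G.t s(u, v))) :
    (G.linearStorageCode y hD hy h).rate = 1 / D := by
  have h1 : 0 < Real.logb 2 (Fintype.card F) :=
    Real.logb_pos one_lt_two (by exact_mod_cast Fintype.one_lt_card)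
  have h2 : (0 : ℝ) < D := by exact_mod_cast hD
  have h3 : (G.linearStorageCode y hD hy h).Lv = D * Real.logb 2 (Fintype.card F) := by
    change Real.logb 2 (Fintype.card (Fin D → F)) = _
    simp [Real.logb_pow]
  rw [SecureStorageCode.rate, h3]
  change Real.logb 2 (Fintype.card F) / _ = _
  field_simp

end StorageGraph

/-! ### The optimal code of a graph without internal qualified edges -/

namespace StorageGraph

variable {V : Type*} {K D : ℕ} (G : StorageGraph V K D)

theorem isQualifiedComponent_setOf_reachable (u : V) :
    G.IsQualifiedComponent {v | G.qualifiedGraph.Reachable u v} := by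
  refine ⟨?_, fun S hS hle w hw => ?_⟩
  · have h : (SimpleGraph.induce {v | G.qualifiedGraph.Reachable u v}
        G.qualifiedGraph).Connected := by
      have h1 := (G.qualifiedGraph.connectedComponentMk u).connected_toSimpleGraph
      have h2 : (G.qualifiedGraph.connectedComponentMk u).supp =
          {v | G.qualifiedGraph.Reachable u v} := by
        ext v
        simp only [SimpleGraph.ConnectedComponent.mem_supp_iff, SimpleGraph.ConnectedComponent.eq,
          Set.mem_ofPred_eq]
        exact SimpleGraph.reachable_comm
      rw [← h2]
      exact h1
    exact h
  · have hu : u ∈ S := hle (SimpleGraph.Reachable.refl u)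
    exact (hS.preconnected ⟨u, hu⟩ ⟨w, hw⟩).map
      (⟨Subtype.val, fun h => ⟨h.1, h.2⟩⟩ : (G.induce S).qualifiedGraph →g G.qualifiedGraph)

/-- The edges inside qualified components that are not associated with `W k`. -/
def avoidingGraph (k : Fin K) : SimpleGraph V where
  Adj u v := G.graph.Adj u v ∧ k ∉ G.t s(u, v) ∧ G.qualifiedGraph.Reachable u v
  symm := ⟨fun u v h => ⟨h.1.symm, by rw [Sym2.eq_swap]; exact h.2.1, h.2.2.symm⟩⟩
  loopless := ⟨fun v h => G.graph.loopless.irrefl v h.1⟩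

theorem reachable_charGraph_of_avoidingGraph {k : Fin K} {Q : Set V}
    (hQ : ∀ u ∈ Q, ∀ v, G.qualifiedGraph.Reachable u v → v ∈ Q) {u v : V}
    (p : (G.avoidingGraph k).Walk u v) (hu : u ∈ Q) :
    ∃ hv : v ∈ Q, ((G.induce Q).charGraph k).unqualifiedGraph.Reachable ⟨u, hu⟩ ⟨v, hv⟩ := by
  induction p with
  | nil => exact ⟨hu, SimpleGraph.Reachable.refl _⟩
  | @cons u w v h p ih =>
    have hw := hQ u hu w h.2.2
    obtain ⟨hv, hr⟩ := ih hw
    have hadj : ((G.induce Q).charGraph k).unqualifiedGraph.Adj ⟨u, hu⟩ ⟨w, hw⟩ :=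
      ⟨h.1, if_neg h.2.1⟩
    exact ⟨hv, hadj.reachable.trans hr⟩

/-- A connecting walk would stay in the qualified component of u and be an unqualified path of its
characteristic graph, making the edge internal. -/
theorem not_reachable_avoidingGraph (hint : ∀ Q : Set V, G.IsQualifiedComponent Q → ∀ k : Fin K,
      ¬ ((G.induce Q).charGraph k).HasInternalQualifiedEdge)
    {u v : V} {k : Fin K} (h : G.graph.Adj u v) (hk : k ∈ G.t s(u, v)) :
    ¬ (G.avoidingGraph k).Reachable u v := by
  rintro ⟨p⟩
  refine hint _ (G.isQualifiedComponent_setOf_reachable u) k ?_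
  obtain ⟨hv, ⟨q⟩⟩ := G.reachable_charGraph_of_avoidingGraph
    (Q := {v | G.qualifiedGraph.Reachable u v}) (fun a ha b hb => SimpleGraph.Reachable.trans ha hb)
    p (SimpleGraph.Reachable.refl u)
  refine ⟨⟨u, SimpleGraph.Reachable.refl u⟩, ⟨v, hv⟩, ⟨h, ?_⟩, _, _, q, q.start_mem_support,
    q.end_mem_support⟩
  have h1 : (if k ∈ G.t s(u, v) then ({k} : Finset (Fin K)) else ∅) ≠ ∅ := by simp [hk]
  exact h1

theorem mem_t_iff_of_isDegenerate {u v : V} (hv : G.IsDegenerate v) (h : G.graph.Adj u v)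
    (k : Fin K) : k ∈ G.commonSources v ↔ k ∈ G.t s(u, v) := by
  rw [← hv u h.symm, Sym2.eq_swap, Finset.mem_coe]

theorem exists_rate_eq [Finite V] (hD : 0 < D)
    (hint : ∀ Q : Set G.nonDegenerateNodes, G.nonDegenerateSubgraph.IsQualifiedComponent Q →
      ∀ k : Fin K, ¬ ((G.nonDegenerateSubgraph.induce Q).charGraph k).HasInternalQualifiedEdge) :
    ∃ c : G.SecureStorageCode, c.rate = 1 / D := by
  classical
  obtain ⟨m, ⟨e⟩⟩ := Finite.exists_equiv_fin G.nonDegenerateNodes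
  -- The field needs K distinct Vandermonde nodes and m distinct coefficient values.
  obtain ⟨q, hq, hqp⟩ := Nat.exists_infinite_primes (K + m)
  have := Fact.mk hqp
  have hcast : ∀ {r : ℕ}, r ≤ q → ∀ a b : Fin r, ((a : ℕ) : ZMod q) = ((b : ℕ) : ZMod q) →
      a = b := by
    intro r hr a b hab
    rw [ZMod.natCast_eq_natCast_iff', Nat.mod_eq_of_lt (a.2.trans_le hr),
      Nat.mod_eq_of_lt (b.2.trans_le hr)] at hab
    exact Fin.ext hab
  -- The number of a chosen node in the component of v serves as a component name, both for noise
  -- indices and for coefficients.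
  let rep (H : SimpleGraph G.nonDegenerateNodes) (v : G.nonDegenerateNodes) : Fin m :=
    e (H.connectedComponentMk v).out
  have hrep : ∀ H u v, rep H u = rep H v ↔ H.Reachable u v := by
    intro H u v
    simp only [rep, e.injective.eq_iff]
    rw [← SimpleGraph.ConnectedComponent.eq]
    refine ⟨fun h => ?_, fun h => by rw [h]⟩
    rw [← Quot.out_eq (H.connectedComponentMk u), ← Quot.out_eq (H.connectedComponentMk v)]
    exact congrArg _ h
  let n (v : V) : Option (Fin m) :=
    if h : v ∈ G.nonDegenerateNodes then some (rep G.nonDegenerateSubgraph.qualifiedGraph ⟨v, h⟩)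
    else none
  let x (v : V) (k : Fin K) : ZMod q :=
    if h : v ∈ G.nonDegenerateNodes then
      ((rep (G.nonDegenerateSubgraph.avoidingGraph k) ⟨v, h⟩ : ℕ) : ZMod q)
    else if k ∈ G.commonSources v then 1 else 0
  have hx0 : ∀ v, v ∉ G.nonDegenerateNodes → ∀ k, x v k ≠ 0 ↔ k ∈ G.commonSources v := by
    intro v hv k
    simp [x, hv]
  refine ⟨G.linearStorageCode (n := n) (x := x) (fun k : Fin K => ((k : ℕ) : ZMod q)) hD
    (fun a b => hcast (by omega) a b) fun u v huv => ?_, G.rate_linearStorageCode _ hD _ _⟩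
  unfold IsLinearScheme
  by_cases hu : u ∈ G.nonDegenerateNodes <;> by_cases hv : v ∈ G.nonDegenerateNodes
  · have hnu : n u = some (rep G.nonDegenerateSubgraph.qualifiedGraph ⟨u, hu⟩) := dif_pos hu
    have hnv : n v = some (rep G.nonDegenerateSubgraph.qualifiedGraph ⟨v, hv⟩) := dif_pos hv
    simp only [hnu, hnv, hrep]
    split_ifs with hr
    · intro k
      simp only [Pi.sub_apply, x, dif_pos hu, dif_pos hv, ne_eq, sub_eq_zero]
      refine ⟨fun h => ?_, fun hk h => ?_⟩
      · by_contra hk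
        refine h (congrArg _ (congrArg _ ((hrep _ _ _).2 (SimpleGraph.Adj.reachable ?_))))
        exact ⟨huv, hk, hr⟩
      · exact not_reachable_avoidingGraph _ hint (u := ⟨u, hu⟩) (v := ⟨v, hv⟩) huv hk
          ((hrep _ _ _).1 (hcast (by omega) _ _ h))
    · by_contra ht
      exact hr (SimpleGraph.Adj.reachable ⟨huv, ht⟩)
  · simp only [n, dif_pos hu, dif_neg hv]
    exact fun k => (hx0 v hv k).trans (G.mem_t_iff_of_isDegenerate (not_not.1 hv) huv k)
  · simp only [n, dif_neg hu, dif_pos hv]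
    exact fun k => (hx0 u hu k).trans
      ((G.mem_t_iff_of_isDegenerate (not_not.1 hu) huv.symm k).trans (by rw [Sym2.eq_swap]))
  · simp only [n, dif_neg hu, dif_neg hv]
    exact ⟨fun k => (hx0 u hu k).trans
      ((G.mem_t_iff_of_isDegenerate (not_not.1 hu) huv.symm k).trans (by rw [Sym2.eq_swap])),
      fun k => (hx0 v hv k).trans (G.mem_t_iff_of_isDegenerate (not_not.1 hv) huv k)⟩

end StorageGraph

theorem theorem2 {V : Type*} [Finite V] (K D : ℕ) (G : StorageGraph V K D)
    (hne : G.nonDegenerateNodes.Nonempty)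
    (hC : ∀ v ∈ G.nonDegenerateNodes, G.commonSources v = ∅) :
    G.capacity = ((1 / (D : ℝ) : ℝ) : EReal) ↔
      ∀ Q : Set G.nonDegenerateNodes, G.nonDegenerateSubgraph.IsQualifiedComponent Q →
        ∀ k : Fin K,
          ¬ ((G.nonDegenerateSubgraph.induce Q).charGraph k).HasInternalQualifiedEdge := by
  obtain ⟨u, hu⟩ := hne
  -- This edge provides both `0 < D` and the upper bound 1/D.
  obtain ⟨v, huv, hq⟩ := G.exists_qualified_edge hu (hC u hu)
  refine ⟨fun h Q hQ k hk => ?_, fun h => ?_⟩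
  · exact (G.capacity_lt_of_hasInternalQualifiedEdge hC hQ.prop hk).ne h
  · refine le_antisymm (G.capacity_le (hC u hu) huv hq) ?_
    obtain ⟨c, hc⟩ := G.exists_rate_eq (G.pos_of_qualified_edge huv hq) h
    rw [← hc]
    exact le_iSup (fun c : G.SecureStorageCode => (c.rate : EReal)) c
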